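/- For $n\ge 3$ let $\mathcal T(n)$ be the set of all $2$-trees on the labelled vertex set $[n]=\{1,\dots,n\}$, that is, of all $2$-dimensional simplicial complexes $T$ on $[n]$ with complete $1$-skeleton (every pair of vertices spans an edge) and with $H_1(T;\mathbb Q)=H_2(T;\mathbb Q)=0$. For such $T$ the integral homology group $H_1(T)=H_1(T;\mathbb Z)$ is finite, and $|H_1(T)|$ denotes its order. Let $T$ be random, distributed by the determinantal measure on $\mathcal T(n)$, i.e. by the probability measure for which the probability of each $T\in\mathcal T(n)$ is proportional to $|H_1(T)|^2$. Then for every $n\ge 3$ $$\mathbb E\,|H_1(T)|\;\ge\;\left(\sqrt{\frac3e}\right)^{\binom{n-2}{2}}\left(\sqrt{\frac{3}{en}}\right)^{n-2}.$$ In particular $\mathbb E\,|H_1(T)|=\exp(\Theta(n^2))$: there are constants $c,C>0$ and $N$ such that $\exp(cn^2)\le \mathbb E\,|H_1(T)|\le \exp(Cn^2)$ for all $n\ge N$. -/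

import Mathlib

set_option maxSynthPendingDepth 3

noncomputable section

namespace Hypertree

/-- The faces of `K` having exactly `m` vertices, that is, of dimension `m - 1`. There are none for
`m = 0`, because faces are nonempty. -/
abbrev FacesOfCard {V : Type*} (K : AbstractSimplicialComplex V) (m : ℕ) : Type _ :=
  {s : Finset V // s ∈ K.faces ∧ s.card = m}

/-- Simplicial chains with coefficients in `R`, spanned by the faces with `m` vertices, each face
being oriented by the order of the vertices. -/
abbrev Chain {V : Type*} (K : AbstractSimplicialComplex V) (R : Type*) [CommRing R] (m : ℕ) :
    Type _ :=
  FacesOfCard K m →₀ R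

/-- The boundary map from `d`-dimensional to `(d - 1)`-dimensional simplicial chains:
`∂ [v₀ < ⋯ < v_d] = ∑ i, (-1) ^ i [v₀, …, v̂ᵢ, …, v_d]`. The index of a vertex `v` of `s` is the
number of vertices of `s` below it. The face `s.erase v` is missing from `K` only if it is empty,
i.e. if `d = 0`, and then the boundary map is zero. -/
def boundary {V : Type*} [LinearOrder V] (K : AbstractSimplicialComplex V)
    (R : Type*) [CommRing R] (d : ℕ) : Chain K R (d + 1) →ₗ[R] Chain K R d :=
  Finsupp.linearCombination R fun s : FacesOfCard K (d + 1) =>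
    ∑ v : {v : V // v ∈ s.1},
      open scoped Classical in
      if h : s.1.erase v.1 ∈ K.faces then
        Finsupp.single
          (⟨s.1.erase v.1, h, by rw [Finset.card_erase_of_mem v.2, s.2.2]; rfl⟩ : FacesOfCard K d)
          ((-1 : R) ^ (s.1.filter (fun w => w < v.1)).card)
      else 0

/-- The simplicial homology `H_d(K; R)`: cycles modulo boundaries. -/
abbrev Homology {V : Type*} [LinearOrder V] (K : AbstractSimplicialComplex V)
    (R : Type*) [CommRing R] (d : ℕ) : Type _ :=
  LinearMap.ker (boundary K R d) ⧸
    (LinearMap.range (boundary K R (d + 1))).submoduleOf (LinearMap.ker (boundary K R d))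

/-- A `2`-tree: a `2`-dimensional simplicial complex with complete `1`-skeleton and with
`H_1(K; ℚ) = H_2(K; ℚ) = 0`. -/
structure IsTwoTree {V : Type*} [LinearOrder V] (K : AbstractSimplicialComplex V) : Prop where
  card_le : ∀ s ∈ K.faces, s.card ≤ 3
  exists_card_eq : ∃ s ∈ K.faces, s.card = 3
  complete : ∀ u v : V, u ≠ v → {u, v} ∈ K.faces
  homology_one : Subsingleton (Homology K ℚ 1)
  homology_two : Subsingleton (Homology K ℚ 2)

instance instFiniteComplex (n : ℕ) : Finite (AbstractSimplicialComplex (Fin n)) :=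
  Finite.of_injective (fun K => (K.faces : Set (Finset (Fin n))))
    (fun _ _ h => AbstractSimplicialComplex.ext h)

/-- The set `𝒯(n)` of all `2`-trees on a fixed (labelled, ordered) set of `n` vertices. -/
def twoTrees (n : ℕ) : Finset (AbstractSimplicialComplex (Fin n)) :=
  (Set.toFinite {K | IsTwoTree K}).toFinset

/-- The order `|H_1(K)|` of the first integral homology group, as a real number. -/
def orderH1 {n : ℕ} (K : AbstractSimplicialComplex (Fin n)) : ℝ :=
  (Nat.card (Homology K ℤ 1) : ℝ)

/-- The probability of the `2`-tree `K` under the determinantal measure on `𝒯(n)`, which is the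
probability measure on `𝒯(n)` proportional to `|H_1(K)| ^ 2`. -/
def prob (n : ℕ) (K : AbstractSimplicialComplex (Fin n)) : ℝ :=
  orderH1 K ^ 2 / ∑ T ∈ twoTrees n, orderH1 T ^ 2

/-- The expectation of `|H_1(T)|` for `T` distributed by the determinantal measure on `𝒯(n)`. -/
def expectedOrderH1 (n : ℕ) : ℝ :=
  ∑ T ∈ twoTrees n, prob n T * orderH1 T

end Hypertree

end

/-!
Write `m = (n - 1).choose 2`, let `T` run over the `2`-trees, let `h T = |H₁(T; ℤ)|`, and fix a
vertex `o`. A `1`-cycle in a complex with complete `1`-skeleton is determined by its coefficients at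
the `m` edges avoiding `o`, and these are arbitrary (`cyclesEquiv`). So `H₁` is the cokernel, and
the `2`-cycles form the kernel, of the boundary matrix with only the rows of those edges retained.
Hence a set of `m` triangles spans a `2`-tree exactly when the corresponding maximal minor is
nonzero, every `2`-tree arises in this way, and the absolute value of the minor is `h T`
(`isTwoTree_of_det_ne_zero`, `IsTwoTree.nonempty_equiv`, `IsTwoTree.card_homology_one`).

By the Cauchy–Binet formula (`factorial_mul_det_mul`), `∑ h T ^ 2` is the determinant of the reduced
Laplacian. Since the Laplacian of the full simplex is `n` times the identity, Sylvester's identity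
reduces this to a determinant of the form `det (1 + J)`, where `J` is the all-ones matrix indexed by
the vertices other than `o`, and gives Kalai's formula `∑ h T ^ 2 = n ^ (n - 2).choose 2`; only `≥`
is used (`pow_le_sum_orderH1_sq`).

All the sign bookkeeping is done once, for operators on the span of all subsets of the vertex set.
There the boundary map is the sum of the annihilation operators of the exterior algebra, and its
vanishing square, the cone homotopy and the Laplacian all follow from the anticommutation relations
(`annihilate_mul_annihilate`, `annihilate_mul_transpose`).

For the lower bound, the power mean inequality `(∑ h ^ 2) ^ 3 ≤ (∑ h ^ 3) ^ 2 * N`, where `N` is the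
number of `2`-trees, bounds the square of the expectation `∑ h ^ 3 / ∑ h ^ 2` below by
`∑ h ^ 2 / N`, and `N ≤ (n.choose 3).choose m ≤ (e * n / 3) ^ m`. For the upper bound, each column
of the boundary matrix has at most three entries `±1`, so `h T ≤ 3 ^ m`.
-/

namespace Hypertree

/-! ### Annihilation operators and the full simplex -/

section Fermions

variable {V : Type*} [LinearOrder V]

/-- The sign `(-1) ^ i`, where `i` is the number of elements of `s` below `v`. -/
def sgn (s : Finset V) (v : V) : ℤ := (-1) ^ (s.filter (fun w => w < v)).card

lemma sgn_mul_self (s : Finset V) (v : V) : sgn s v * sgn s v = 1 := by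
  simp [sgn, ← mul_pow]

lemma sgn_insert {s : Finset V} {u : V} (hu : u ∉ s) (v : V) :
    sgn (insert u s) v = (if u < v then -1 else 1) * sgn s v := by
  unfold sgn
  rw [Finset.filter_insert]
  split_ifs with h
  · rw [Finset.card_insert_of_notMem (by simp [hu]), pow_succ]; ring
  · simp

lemma sgn_erase {s : Finset V} {u : V} (hu : u ∈ s) (v : V) :
    sgn (s.erase u) v = (if u < v then -1 else 1) * sgn s v := by
  conv_rhs => rw [← Finset.insert_erase hu, sgn_insert (Finset.notMem_erase u s)]
  split_ifs <;> simp

lemma sgn_insert_self (s : Finset V) (u : V) : sgn (insert u s) u = sgn s u := by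
  by_cases h : u ∈ s
  · rw [Finset.insert_eq_of_mem h]
  · rw [sgn_insert h]; simp

/-- The annihilation operator of `u` on the exterior algebra of `ℤ^V`, in the basis indexed by
`Finset V`: it removes the vertex `u` from the sets containing it, with the sign of the
simplicial boundary map, and kills the other sets. -/
def annihilate (u : V) : Matrix (Finset V) (Finset V) ℤ :=
  fun s t => if u ∈ t ∧ t.erase u = s then sgn t u else 0

lemma annihilate_apply (u : V) (s t : Finset V) :
    annihilate u s t = if u ∉ s ∧ insert u s = t then sgn s u else 0 := by
  unfold annihilate
  have key : (u ∈ t ∧ t.erase u = s) ↔ (u ∉ s ∧ insert u s = t) := by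
    constructor
    · rintro ⟨h, rfl⟩; simp [h]
    · rintro ⟨h, rfl⟩; simp [h]
  simp only [key]
  split_ifs with h
  · rw [← h.2, sgn_insert_self]
  · rfl

variable [Fintype V]

lemma annihilate_mul_apply (u : V) (N : Matrix (Finset V) (Finset V) ℤ) (s t : Finset V) :
    (annihilate u * N) s t = if u ∈ s then 0 else sgn s u * N (insert u s) t := by
  simp only [Matrix.mul_apply, annihilate_apply]
  by_cases h : u ∈ s <;> simp [h]

lemma annihilate_transpose_mul_apply (u : V) (N : Matrix (Finset V) (Finset V) ℤ)
    (s t : Finset V) :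
    ((annihilate u).transpose * N) s t = if u ∈ s then sgn s u * N (s.erase u) t else 0 := by
  simp only [Matrix.mul_apply, Matrix.transpose_apply, annihilate]
  by_cases h : u ∈ s <;> simp [h]

/-- Annihilation operators anticommute. -/
lemma annihilate_mul_annihilate (u w : V) :
    annihilate u * annihilate w + annihilate w * annihilate u = 0 := by
  ext s t
  rw [Matrix.add_apply, annihilate_mul_apply, annihilate_mul_apply, annihilate_apply,
    annihilate_apply, Finset.insert_comm w u]
  rcases eq_or_ne u w with rfl | huw
  · simp
  by_cases hu : u ∈ s
  · simp [hu]
  by_cases hw : w ∈ s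
  · simp [hw]
  by_cases ht : insert u (insert w s) = t
  · simp only [hu, hw, ht, Finset.mem_insert, huw, huw.symm, sgn_insert hu,
      sgn_insert hw]
    rcases lt_or_gt_of_ne huw with h | h <;> simp [h, h.not_gt] <;> ring
  · simp [ht]

/-- The canonical anticommutation relations between annihilation and creation operators. -/
lemma annihilate_mul_transpose (u w : V) :
    annihilate u * (annihilate w).transpose + (annihilate w).transpose * annihilate u
      = if u = w then 1 else 0 := by
  ext s t
  rw [Matrix.add_apply, annihilate_mul_apply, annihilate_transpose_mul_apply,
    Matrix.transpose_apply]
  rw [annihilate_apply u (s.erase w) t, annihilate]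
  rcases eq_or_ne u w with rfl | huw
  · rw [if_pos rfl, Matrix.one_apply]
    by_cases hu : u ∈ s
    · by_cases h : s = t
      · subst h; simp [hu, sgn_erase, sgn_mul_self]
      · simp [hu, h]
    · by_cases h : s = t
      · subst h; simp [hu, sgn_insert, sgn_mul_self]
      · simp [hu, h]
  · rw [if_neg huw]
    by_cases hu : u ∈ s
    · simp [hu, huw]
    by_cases hw : w ∈ s
    · have h1 : (insert u s).erase w = insert u (s.erase w) :=
        Finset.erase_insert_of_ne huw
      by_cases ht : insert u (s.erase w) = t
      · simp only [hu, hw, h1, ht, Finset.mem_insert, Finset.mem_erase, sgn_insert hu,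
          sgn_erase hw]
        rcases lt_or_gt_of_ne huw with h | h <;> simp [h, h.not_gt] <;> ring
      · simp [h1, ht]
    · simp [hw, huw.symm]

variable (V) in
/-- The simplicial boundary map of the full simplex on `V`, augmented by the empty face, as a
matrix indexed by all subsets of `V`. -/
def fullBoundary : Matrix (Finset V) (Finset V) ℤ := ∑ u, annihilate u

lemma fullBoundary_apply (s t : Finset V) :
    fullBoundary V s t = ∑ u ∈ t, if t.erase u = s then sgn t u else 0 := by
  rw [fullBoundary, Matrix.sum_apply, ← Finset.sum_subset (Finset.subset_univ t)]
  · refine Finset.sum_congr rfl fun u hu => ?_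
    simp [annihilate, hu]
  · intro u _ hu
    simp [annihilate, hu]

lemma fullBoundary_mul_self : fullBoundary V * fullBoundary V = 0 := by
  have h : fullBoundary V * fullBoundary V + fullBoundary V * fullBoundary V = 0 := by
    have h1 : fullBoundary V * fullBoundary V = ∑ u : V, ∑ w, annihilate u * annihilate w := by
      simp only [fullBoundary, Finset.sum_mul_sum]
    have h2 : fullBoundary V * fullBoundary V = ∑ u : V, ∑ w, annihilate w * annihilate u := by
      rw [h1, Finset.sum_comm]
    nth_rewrite 1 [h1]
    rw [h2]
    simp only [← Finset.sum_add_distrib, annihilate_mul_annihilate, Finset.sum_const_zero]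
  ext s t
  have := congrFun (congrFun h s) t
  simp only [Matrix.add_apply, Matrix.zero_apply] at this ⊢
  omega

/-- The creation operator of `o` is the cone construction with apex `o`: a contracting homotopy
of the full simplex. -/
lemma fullBoundary_mul_cone (o : V) :
    fullBoundary V * (annihilate o).transpose + (annihilate o).transpose * fullBoundary V = 1 := by
  simp only [fullBoundary, Finset.sum_mul, Finset.mul_sum, ← Finset.sum_add_distrib,
    annihilate_mul_transpose]
  simp

/-- The Laplacian of the full simplex is scalar. -/
lemma fullBoundary_laplacian :
    fullBoundary V * (fullBoundary V).transpose + (fullBoundary V).transpose * fullBoundary V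
      = (Fintype.card V : ℤ) • (1 : Matrix (Finset V) (Finset V) ℤ) := by
  have h1 : fullBoundary V * (fullBoundary V).transpose
      = ∑ u : V, ∑ w : V, annihilate u * (annihilate w).transpose := by
    simp only [fullBoundary, Matrix.transpose_sum, Finset.sum_mul_sum]
  have h2 : (fullBoundary V).transpose * fullBoundary V
      = ∑ u : V, ∑ w : V, (annihilate w).transpose * annihilate u := by
    rw [Finset.sum_comm]
    simp only [fullBoundary, Matrix.transpose_sum, Finset.sum_mul_sum]
  rw [h1, h2]
  simp only [← Finset.sum_add_distrib, annihilate_mul_transpose]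
  simp

lemma fullBoundary_eq_zero {s t : Finset V} (h : t.card ≠ s.card + 1) :
    fullBoundary V s t = 0 := by
  rw [fullBoundary_apply]
  refine Finset.sum_eq_zero fun u hu => if_neg ?_
  rintro rfl
  rw [Finset.card_erase_add_one hu] at h
  exact h rfl

lemma fullBoundary_eq_zero_of_not_subset {s t : Finset V} (h : ¬ s ⊆ t) :
    fullBoundary V s t = 0 := by
  rw [fullBoundary_apply]
  refine Finset.sum_eq_zero fun u hu => if_neg ?_
  rintro rfl
  exact h (Finset.erase_subset _ _)

end Fermions

/-! ### The Cauchy–Binet formula and the reduced Laplacian -/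

section CauchyBinet

variable {m N R : Type*} [Fintype m] [DecidableEq m] [Fintype N] [CommRing R]

/-- Expansion of the determinant of a product along all choices of columns of the left factor. -/
lemma det_mul_eq_sum_functions (A : Matrix m N R) (B : Matrix N m R) :
    (A * B).det = ∑ f : m → N, (∏ i, B (f i) i) * (A.submatrix id f).det := by
  classical
  simp only [Matrix.det_apply', Matrix.mul_apply, Finset.prod_univ_sum, Finset.mul_sum,
    Fintype.piFinset_univ]
  rw [Finset.sum_comm]
  refine Finset.sum_congr rfl fun f _ => Finset.sum_congr rfl fun σ _ => ?_
  rw [Finset.prod_mul_distrib]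
  simp only [Matrix.submatrix_apply, id]
  ring

/-- The **Cauchy–Binet formula**, in the form in which the minors are indexed by all maps to the
inner index type; each set of columns is counted `|m|!` times. -/
lemma factorial_mul_det_mul (A : Matrix m N R) (B : Matrix N m R) :
    ((Fintype.card m).factorial : R) * (A * B).det
      = ∑ f : m → N, (A.submatrix id f).det * (B.submatrix f id).det := by
  classical
  -- Reindexing the choices of columns by `σ` multiplies the minor of `A` by the sign of `σ`.
  have h : ∀ σ : Equiv.Perm m, ∑ f : m → N,
      (A.submatrix id f).det * (((Equiv.Perm.sign σ : ℤ) : R) * ∏ i, B (f (σ i)) i)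
        = (A * B).det := by
    intro σ
    rw [det_mul_eq_sum_functions]
    refine Fintype.sum_equiv (Equiv.arrowCongr σ.symm (Equiv.refl N)) _ _ fun f => ?_
    have : (A.submatrix id (Equiv.arrowCongr σ.symm (Equiv.refl N) f)).det
        = ((Equiv.Perm.sign σ : ℤ) : R) * (A.submatrix id f).det := by
      rw [← Matrix.det_permute' σ (A.submatrix id f)]
      rfl
    rw [this]
    simp only [Equiv.arrowCongr_apply, Function.comp_apply, Equiv.symm_symm, Equiv.refl_apply]
    ring
  have h2 : ∀ f : m → N, (B.submatrix f id).det
      = ∑ σ : Equiv.Perm m, ((Equiv.Perm.sign σ : ℤ) : R) * ∏ i, B (f (σ i)) i := by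
    intro f
    rw [Matrix.det_apply']
    rfl
  calc _ = ∑ σ : Equiv.Perm m, (A * B).det := by
        rw [Finset.sum_const, Finset.card_univ, Fintype.card_perm, nsmul_eq_mul]
    _ = ∑ σ : Equiv.Perm m, ∑ f : m → N,
          (A.submatrix id f).det * (((Equiv.Perm.sign σ : ℤ) : R) * ∏ i, B (f (σ i)) i) :=
        Finset.sum_congr rfl fun σ _ => (h σ).symm
    _ = _ := by
        rw [Finset.sum_comm]
        refine Finset.sum_congr rfl fun f _ => ?_
        rw [h2 f, Finset.mul_sum]

/-- The determinant of an integer matrix is at most the product of the `ℓ¹` norms of its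
columns. -/
lemma abs_det_le_prod_sum (A : Matrix m m ℤ) : |A.det| ≤ ∏ j, ∑ i, |A i j| := by
  rw [Matrix.det_apply', Finset.prod_univ_sum, Fintype.piFinset_univ]
  refine (Finset.abs_sum_le_sum_abs _ _).trans ?_
  have h : ∀ σ : Equiv.Perm m, |((Equiv.Perm.sign σ : ℤ)) * ∏ i, A (σ i) i|
      = ∏ i, |A ((σ : m → m) i) i| := by
    intro σ
    rw [abs_mul, Finset.abs_prod, Int.abs_eq_natAbs, Int.units_natAbs]
    simp
  calc _ = ∑ σ : Equiv.Perm m, ∏ i, |A ((σ : m → m) i) i| := Finset.sum_congr rfl fun σ _ => h σ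
    _ = ∑ f ∈ Finset.univ.map ⟨fun σ : Equiv.Perm m => (σ : m → m), DFunLike.coe_injective⟩,
          ∏ i, |A (f i) i| := by rw [Finset.sum_map]; rfl
    _ ≤ _ := Finset.sum_le_sum_of_subset_of_nonneg (Finset.subset_univ _)
          fun f _ _ => Finset.prod_nonneg fun i _ => abs_nonneg _

end CauchyBinet

section Kalai

/-- A sum over a subtype may be extended to the whole type if the summand vanishes outside. -/
lemma sum_subtype_eq {α : Type*} [Fintype α] {P : α → Prop} [DecidablePred P] (g : α → ℤ)
    (hg : ∀ s, ¬ P s → g s = 0) : ∑ s : {s // P s}, g s = ∑ s, g s := by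
  rw [← Finset.sum_subtype (Finset.univ.filter P) (by simp) g, Finset.sum_filter]
  refine Finset.sum_congr rfl fun s _ => ?_
  split_ifs with h
  · rfl
  · rw [hg s h]

variable {V : Type*} [LinearOrder V]

/-- The sets of `d` vertices avoiding the vertex `o`. -/
abbrev Avoiding (o : V) (d : ℕ) : Type _ := {s : Finset V // s.card = d ∧ o ∉ s}

variable [Fintype V]

lemma card_avoiding (o : V) (d : ℕ) :
    Fintype.card (Avoiding o d) = (Fintype.card V - 1).choose d := by
  rw [Fintype.card_subtype]
  have : (Finset.univ.filter fun s : Finset V => s.card = d ∧ o ∉ s)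
      = (Finset.univ.erase o).powersetCard d := by
    ext s
    simp only [Finset.mem_filter, Finset.mem_univ, true_and, Finset.mem_powersetCard,
      Finset.subset_erase, Finset.subset_univ]
    tauto
  rw [this, Finset.card_powersetCard, Finset.card_erase_of_mem (Finset.mem_univ o),
    Finset.card_univ]

/-- The boundary matrix of the complete `2`-complex, its rows restricted to the edges avoiding
`o`. -/
def triangleMatrix (o : V) : Matrix (Avoiding o 2) {t : Finset V // t.card = 3} ℤ :=
  (fullBoundary V).submatrix Subtype.val Subtype.val

/-- The incidence matrix of the complete graph on the vertices different from `o`. -/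
def edgeMatrix (o : V) : Matrix (Avoiding o 1) (Avoiding o 2) ℤ :=
  (fullBoundary V).submatrix Subtype.val Subtype.val

/-- The reduced Laplacian, from the Laplacian of the full simplex: an edge avoiding `o` has no
endpoint `o`, so the vertex `o` contributes nothing to the second term. -/
lemma triangleMatrix_mul_transpose (o : V) :
    triangleMatrix o * (triangleMatrix o).transpose
      = (Fintype.card V : ℤ) • 1 - (edgeMatrix o).transpose * edgeMatrix o := by
  ext e e'
  have hL := congrFun (congrFun (fullBoundary_laplacian (V := V)) e.1) e'.1
  rw [Matrix.add_apply, Matrix.smul_apply, Matrix.mul_apply, Matrix.mul_apply] at hL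
  rw [Matrix.sub_apply, Matrix.smul_apply, Matrix.mul_apply, Matrix.mul_apply]
  have h1 : ∑ t, triangleMatrix o e t * (triangleMatrix o).transpose t e'
      = ∑ t, fullBoundary V e.1 t * (fullBoundary V).transpose t e'.1 := by
    refine sum_subtype_eq (P := fun t => t.card = 3)
      (fun t => fullBoundary V e.1 t * (fullBoundary V).transpose t e'.1) fun t ht => ?_
    rw [fullBoundary_eq_zero (by rw [e.2.1]; exact ht), zero_mul]
  have h2 : ∑ x, (edgeMatrix o).transpose e x * edgeMatrix o x e'
      = ∑ x, (fullBoundary V).transpose e.1 x * fullBoundary V x e'.1 := by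
    refine sum_subtype_eq (P := fun s : Finset V => s.card = 1 ∧ o ∉ s)
      (fun x => (fullBoundary V).transpose e.1 x * fullBoundary V x e'.1) fun x hx => ?_
    rw [Matrix.transpose_apply]
    by_cases hc : x.card = 1
    · rw [fullBoundary_eq_zero_of_not_subset, zero_mul]
      intro hsub
      exact hx ⟨hc, fun ho => e.2.2 (hsub ho)⟩
    · rw [fullBoundary_eq_zero (by rw [e.2.1]; omega), zero_mul]
  have h3 : (1 : Matrix (Finset V) (Finset V) ℤ) e.1 e'.1
      = (1 : Matrix (Avoiding o 2) (Avoiding o 2) ℤ) e e' := by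
    simp only [Matrix.one_apply, Subtype.ext_iff]
  rw [h1, h2, ← h3, ← hL]
  ring

lemma fullBoundary_of_mem {o : V} {s t : Finset V} (hs : o ∉ s) (ht : o ∈ t) :
    fullBoundary V s t = annihilate o s t := by
  rw [fullBoundary, Matrix.sum_apply, Finset.sum_eq_single o]
  · intro u _ hu
    rw [annihilate, if_neg]
    rintro ⟨-, rfl⟩
    exact hs (Finset.mem_erase.2 ⟨hu.symm, ht⟩)
  · simp

/-- The reduced Laplacian of the complete graph. From the Laplacian of the full simplex one takes off
the all-ones matrix, which comes from the empty face, and the identity, which comes from the edges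
through `o`. -/
lemma edgeMatrix_mul_transpose (o : V) :
    edgeMatrix o * (edgeMatrix o).transpose
      = (Fintype.card V : ℤ) • 1 - (1 + Matrix.of fun _ _ => 1) := by
  ext x y
  have hL := congrFun (congrFun (fullBoundary_laplacian (V := V)) x.1) y.1
  have hC := congrFun (congrFun (annihilate_mul_transpose o o) x.1) y.1
  rw [if_pos rfl, Matrix.add_apply, annihilate_transpose_mul_apply, if_neg x.2.2,
    add_zero] at hC
  rw [Matrix.add_apply, Matrix.smul_apply, Matrix.mul_apply, Matrix.mul_apply] at hL
  have hone : ∀ z : Avoiding o 1, fullBoundary V ∅ z.1 = 1 := by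
    intro z
    obtain ⟨v, hv⟩ := Finset.card_eq_one.1 z.2.1
    rw [hv, fullBoundary_apply]
    simp [sgn, Finset.filter_singleton]
  have h2 : ∑ s, (fullBoundary V).transpose x.1 s * fullBoundary V s y.1 = 1 := by
    rw [Finset.sum_eq_single ∅]
    · rw [Matrix.transpose_apply, hone, hone, mul_one]
    · intro s _ hs
      rw [Matrix.transpose_apply, fullBoundary_eq_zero, zero_mul]
      rw [x.2.1]
      have := Finset.card_ne_zero.2 (Finset.nonempty_iff_ne_empty.2 hs)
      omega
    · simp
  have h1 : ∑ e, edgeMatrix o x e * (edgeMatrix o).transpose e y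
      = ∑ e, if o ∈ e then 0 else fullBoundary V x.1 e * (fullBoundary V).transpose e y.1 := by
    rw [← sum_subtype_eq (P := fun s : Finset V => s.card = 2 ∧ o ∉ s)]
    · refine Finset.sum_congr rfl fun e _ => ?_
      rw [if_neg e.2.2]
      rfl
    · intro s hs
      by_cases ho : o ∈ s
      · rw [if_pos ho]
      · rw [if_neg ho, fullBoundary_eq_zero, zero_mul]
        rw [x.2.1]
        tauto
  -- The edges through `o`: only `annihilate o` contributes to their boundary at sets avoiding `o`.
  have h4 : ∑ e, (if o ∈ e then fullBoundary V x.1 e * (fullBoundary V).transpose e y.1 else 0)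
      = (1 : Matrix (Finset V) (Finset V) ℤ) x.1 y.1 := by
    rw [← hC, Matrix.mul_apply]
    refine Finset.sum_congr rfl fun e _ => ?_
    split_ifs with ho
    · rw [Matrix.transpose_apply, fullBoundary_of_mem x.2.2 ho, fullBoundary_of_mem y.2.2 ho]
      rfl
    · simp [annihilate, ho]
  have h5 : ∑ e, fullBoundary V x.1 e * (fullBoundary V).transpose e y.1
      = ∑ e, edgeMatrix o x e * (edgeMatrix o).transpose e y
        + (1 : Matrix (Finset V) (Finset V) ℤ) x.1 y.1 := by
    rw [h1, ← h4, ← Finset.sum_add_distrib]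
    refine Finset.sum_congr rfl fun e _ => ?_
    split_ifs <;> simp
  have h3 : (1 : Matrix (Finset V) (Finset V) ℤ) x.1 y.1
      = (1 : Matrix (Avoiding o 1) (Avoiding o 1) ℤ) x y := by
    simp only [Matrix.one_apply, Subtype.ext_iff]
  rw [h5, h2] at hL
  rw [Matrix.sub_apply, Matrix.smul_apply, Matrix.add_apply, Matrix.of_apply, Matrix.mul_apply,
    ← h3, ← hL]
  ring

/-- The factor `a` is taken out over `ℚ`, where it is invertible. -/
lemma cast_det_smul_one_sub {p q : Type*} [Fintype p] [DecidableEq p] [Fintype q]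
    (a : ℤ) (ha : a ≠ 0) (X : Matrix p q ℤ) (Y : Matrix q p ℤ) :
    (((a • (1 : Matrix p p ℤ) - X * Y).det : ℤ) : ℚ)
      = (a : ℚ) ^ Fintype.card p * (1 - ((a : ℚ)⁻¹ • X.map (Int.cast : ℤ → ℚ))
          * Y.map (Int.cast : ℤ → ℚ)).det := by
  have ha' : (a : ℚ) ≠ 0 := by exact_mod_cast ha
  rw [← Matrix.det_smul, Int.cast_det]
  congr 1
  ext i j
  simp only [Matrix.map_apply, Matrix.sub_apply, Matrix.smul_apply, Matrix.mul_apply,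
    Matrix.one_apply, smul_eq_mul, Int.cast_sub, Int.cast_mul, Int.cast_sum, mul_sub,
    Finset.mul_sum, mul_assoc, mul_inv_cancel_left₀ ha']
  split_ifs <;> simp

/-- Sylvester's determinant identity for characteristic polynomials, evaluated at `a`. -/
lemma pow_mul_det_smul_one_sub {m k : Type*} [Fintype m] [DecidableEq m] [Fintype k]
    [DecidableEq k] (a : ℤ) (ha : a ≠ 0) (D : Matrix k m ℤ) :
    a ^ Fintype.card k * (a • (1 : Matrix m m ℤ) - D.transpose * D).det
      = a ^ Fintype.card m * (a • (1 : Matrix k k ℤ) - D * D.transpose).det := by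
  have h1 := cast_det_smul_one_sub a ha D.transpose D
  have h2 := cast_det_smul_one_sub a ha D D.transpose
  rw [Matrix.smul_mul, ← Matrix.mul_smul, Matrix.det_one_sub_mul_comm] at h1
  have : ((a ^ Fintype.card k * (a • (1 : Matrix m m ℤ) - D.transpose * D).det : ℤ) : ℚ)
      = ((a ^ Fintype.card m * (a • (1 : Matrix k k ℤ) - D * D.transpose).det : ℤ) : ℚ) := by
    rw [Int.cast_mul, Int.cast_mul, Int.cast_pow, Int.cast_pow, h1, h2]
    ring
  exact_mod_cast this

/-- The determinant of the reduced Laplacian, by Sylvester's identity and the matrix determinant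
lemma. -/
lemma det_triangleMatrix_mul_transpose (o : V) (hV : 3 ≤ Fintype.card V) :
    (triangleMatrix o * (triangleMatrix o).transpose).det
      = (Fintype.card V : ℤ) ^ (Fintype.card V - 2).choose 2 := by
  have hn : (Fintype.card V : ℤ) ≠ 0 := by positivity
  have h := pow_mul_det_smul_one_sub (Fintype.card V : ℤ) hn (edgeMatrix o)
  rw [← triangleMatrix_mul_transpose, edgeMatrix_mul_transpose, sub_sub_cancel] at h
  have hJ : (Matrix.of fun _ _ => 1 : Matrix (Avoiding o 1) (Avoiding o 1) ℤ)
      = Matrix.replicateCol Unit (fun _ => (1 : ℤ)) * Matrix.replicateRow Unit (fun _ => (1 : ℤ)) := by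
    ext i j
    simp [Matrix.mul_apply]
  have hdet : (1 + Matrix.of fun _ _ => 1 : Matrix (Avoiding o 1) (Avoiding o 1) ℤ).det
      = Fintype.card V := by
    rw [hJ, Matrix.det_one_add_replicateCol_mul_replicateRow]
    simp only [dotProduct, mul_one, Finset.sum_const, Finset.card_univ, card_avoiding,
      Nat.choose_one_right, nsmul_eq_mul]
    push_cast [Nat.cast_sub (by omega : 1 ≤ Fintype.card V)]
    ring
  rw [hdet, card_avoiding, card_avoiding, Nat.choose_one_right] at h
  obtain ⟨k, hk⟩ : ∃ k, Fintype.card V = k + 2 := ⟨Fintype.card V - 2, by omega⟩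
  rw [hk] at h hn ⊢
  have hc : (k + 2 - 1).choose 2 = k + k.choose 2 := by
    rw [show k + 2 - 1 = k + 1 from rfl, Nat.choose_succ_succ' k 1, Nat.choose_one_right]
  rw [hc, pow_add, show k + 2 - 1 = k + 1 from rfl, pow_succ] at h
  rw [Nat.add_sub_cancel]
  have hp : ((k + 2 : ℕ) : ℤ) ^ k * ((k + 2 : ℕ) : ℤ) ≠ 0 := by positivity
  refine mul_left_cancel₀ hp (h.trans ?_)
  ring

/-- Sum of the squares of the maximal minors of the boundary matrix; the factorial counts the
orderings of the columns. -/
lemma sum_sq_det_triangleMatrix (o : V) (hV : 3 ≤ Fintype.card V) :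
    ∑ f : Avoiding o 2 → {t : Finset V // t.card = 3},
        ((triangleMatrix o).submatrix id f).det ^ 2
      = ((Fintype.card V - 1).choose 2).factorial
          * (Fintype.card V : ℤ) ^ (Fintype.card V - 2).choose 2 := by
  rw [← det_triangleMatrix_mul_transpose o hV, ← card_avoiding o 2, factorial_mul_det_mul]
  refine Finset.sum_congr rfl fun f _ => ?_
  rw [← Matrix.transpose_submatrix, Matrix.det_transpose, sq]

end Kalai

/-! ### Homology as a cokernel -/

section Chains

variable {V : Type*} [LinearOrder V] (K : AbstractSimplicialComplex V) (R : Type*) [CommRing R]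

/-- Extension of a simplicial chain by zero to all sets of vertices. -/
noncomputable def extend (m : ℕ) : Chain K R m →ₗ[R] (Finset V → R) :=
  Finsupp.linearCombination R fun s : FacesOfCard K m => Pi.single s.1 (1 : R)

variable {K R}

lemma extend_apply_mem {m : ℕ} (c : Chain K R m) (s : FacesOfCard K m) :
    extend K R m c s.1 = c s := by
  classical
  rw [extend, Finsupp.linearCombination_apply, Finsupp.sum, Finset.sum_apply,
    Finset.sum_eq_single s]
  · simp
  · intro t _ hts
    have : s.1 ≠ t.1 := fun h => hts (Subtype.ext h.symm)
    simp [this]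
  · intro hs
    simp [Finsupp.notMem_support_iff.1 hs]

lemma extend_apply_notMem {m : ℕ} (c : Chain K R m) (s : Finset V)
    (hs : ¬ (s ∈ K.faces ∧ s.card = m)) : extend K R m c s = 0 := by
  rw [extend, Finsupp.linearCombination_apply, Finsupp.sum, Finset.sum_apply]
  refine Finset.sum_eq_zero fun t _ => ?_
  have : s ≠ t.1 := by rintro rfl; exact hs t.2
  simp [this]

lemma extend_injective (m : ℕ) : Function.Injective (extend K R m) := by
  intro c c' h
  ext s
  rw [← extend_apply_mem, ← extend_apply_mem, h]

variable [Fintype V]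

lemma exists_extend_eq {m : ℕ} (x : Finset V → R)
    (hx : ∀ s, ¬ (s ∈ K.faces ∧ s.card = m) → x s = 0) : ∃ c, extend K R m c = x := by
  refine ⟨Finsupp.equivFunOnFinite.symm fun s => x s.1, funext fun s => ?_⟩
  by_cases hs : s ∈ K.faces ∧ s.card = m
  · exact extend_apply_mem _ ⟨s, hs⟩
  · rw [extend_apply_notMem _ s hs, hx s hs]

variable (V R) in
/-- The boundary matrix of the full simplex with coefficients in `R`. -/
def fullBoundaryOver : Matrix (Finset V) (Finset V) R := (fullBoundary V).map (Int.cast : ℤ → R)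

/-- Extension by zero turns the boundary maps in positive degrees into the boundary map of the full
simplex. -/
lemma extend_boundary (d : ℕ) (c : Chain K R (d + 2)) :
    extend K R (d + 1) (boundary K R (d + 1) c)
      = (fullBoundaryOver V R).mulVec (extend K R (d + 2) c) := by
  have : extend K R (d + 1) ∘ₗ boundary K R (d + 1)
      = (fullBoundaryOver V R).mulVecLin ∘ₗ extend K R (d + 2) := by
    refine Finsupp.lhom_ext' fun t => LinearMap.ext_ring ?_
    simp only [LinearMap.comp_apply, Finsupp.lsingle_apply, boundary, extend,
      Finsupp.linearCombination_single, one_smul, map_sum, Matrix.mulVecLin_apply,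
      Matrix.mulVec_single_one]
    funext s
    rw [Finset.sum_apply, Matrix.col_apply, fullBoundaryOver, Matrix.map_apply,
      fullBoundary_apply, Int.cast_sum, ← Finset.sum_coe_sort t.1]
    refine Finset.sum_congr rfl fun v _ => ?_
    have hf : t.1.erase v.1 ∈ K.faces := by
      refine (K.isRelLowerSet_faces t.2.1).2 (Finset.erase_subset _ _) ?_
      rw [← Finset.card_pos, Finset.card_erase_of_mem v.2, t.2.2]
      omega
    rw [dif_pos hf, Finsupp.linearCombination_single]
    by_cases h : t.1.erase v.1 = s
    · subst h
      simp [sgn]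
    · simp [h, Ne.symm h]
  exact LinearMap.congr_fun this c

lemma fullBoundaryOver_mul_self : fullBoundaryOver V R * fullBoundaryOver V R = 0 := by
  have := congrArg (fun M => M.map (Int.castRingHom R)) (fullBoundary_mul_self (V := V))
  rwa [Matrix.map_mul, Matrix.map_zero _ (map_zero (Int.castRingHom R))] at this

variable (R) in
/-- The cone construction with apex `o`, with coefficients in `R`. -/
def coneOver (o : V) : Matrix (Finset V) (Finset V) R :=
  (annihilate o).transpose.map (Int.cast : ℤ → R)

omit [Fintype V] in
lemma coneOver_apply (o : V) (s t : Finset V) :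
    coneOver R o s t = if o ∈ s ∧ s.erase o = t then (sgn s o : R) else 0 := by
  simp only [coneOver, Matrix.map_apply, Matrix.transpose_apply, annihilate]
  split_ifs <;> simp

lemma coneOver_mulVec (o : V) (x : Finset V → R) (s : Finset V) :
    (coneOver R o).mulVec x s = if o ∈ s then (sgn s o : R) * x (s.erase o) else 0 := by
  simp only [Matrix.mulVec, dotProduct, coneOver_apply]
  by_cases h : o ∈ s <;> simp [h]

lemma fullBoundaryOver_mul_cone (o : V) :
    fullBoundaryOver V R * coneOver R o + coneOver R o * fullBoundaryOver V R = 1 := by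
  have := congrArg (fun M => M.map (Int.castRingHom R)) (fullBoundary_mul_cone o)
  rwa [Matrix.map_add _ (map_add (Int.castRingHom R)), Matrix.map_mul, Matrix.map_mul,
    Matrix.map_one _ (map_zero (Int.castRingHom R)) (map_one (Int.castRingHom R))] at this

lemma boundary_boundary (d : ℕ) (c : Chain K R (d + 3)) :
    boundary K R (d + 1) (boundary K R (d + 2) c) = 0 := by
  apply extend_injective
  rw [extend_boundary, extend_boundary, Matrix.mulVec_mulVec, fullBoundaryOver_mul_self,
    Matrix.zero_mulVec, map_zero]

variable (K R) in
/-- Restriction of a `1`-chain to the edges avoiding the vertex `o`. -/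
noncomputable def restrictAvoiding (o : V) : Chain K R 2 →ₗ[R] (Avoiding o 2 → R) :=
  LinearMap.funLeft R R Subtype.val ∘ₗ extend K R 2

omit [Fintype V] in
lemma restrictAvoiding_apply (o : V) (c : Chain K R 2) (e : Avoiding o 2) :
    restrictAvoiding K R o c e = extend K R 2 c e.1 := rfl

/-- A cycle is the boundary of its cone, which only depends on the edges avoiding the apex. -/
lemma eq_zero_of_restrictAvoiding (o : V) (c : Chain K R 2) (hc : boundary K R 1 c = 0)
    (h : restrictAvoiding K R o c = 0) : c = 0 := by
  apply extend_injective
  have hcone : (coneOver R o).mulVec (extend K R 2 c) = 0 := by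
    funext s
    rw [coneOver_mulVec]
    split_ifs with hs
    · by_cases hcard : (s.erase o).card = 2
      · have := congrFun h ⟨s.erase o, hcard, Finset.notMem_erase o s⟩
        rw [restrictAvoiding_apply] at this
        rw [this]; simp
      · rw [extend_apply_notMem _ _ fun h' => hcard h'.2]; simp
    · rfl
  have hb := extend_boundary 0 c
  rw [hc, map_zero] at hb
  have := congrArg (fun M => M.mulVec (extend K R 2 c)) (fullBoundaryOver_mul_cone (R := R) o)
  simp only [Matrix.add_mulVec, ← Matrix.mulVec_mulVec, Matrix.one_mulVec, hcone, ← hb,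
    Matrix.mulVec_zero, add_zero] at this
  rw [← this, map_zero]

/-- Prescribed coefficients at the edges avoiding `o` extend to a cycle. -/
lemma exists_cycle_restrictAvoiding (hK : ∀ u v : V, u ≠ v → {u, v} ∈ K.faces) (o : V)
    (x : Avoiding o 2 → R) :
    ∃ c : Chain K R 2, boundary K R 1 c = 0 ∧ restrictAvoiding K R o c = x := by
  classical
  let y : Finset V → R := fun s => if h : s.card = 2 ∧ o ∉ s then x ⟨s, h⟩ else 0
  -- The boundary of the cone over `x` is a cycle; the other half of the homotopy formula vanishes
  -- on sets avoiding the apex `o`.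
  let z := (fullBoundaryOver V R).mulVec ((coneOver R o).mulVec y)
  obtain ⟨c, hc⟩ : ∃ c, extend K R 2 c = z := by
    refine exists_extend_eq z fun s hs => ?_
    have hs2 : s.card ≠ 2 := by
      intro h2
      obtain ⟨u, v, huv, rfl⟩ := Finset.card_eq_two.1 h2
      exact hs ⟨hK u v huv, h2⟩
    refine Finset.sum_eq_zero fun t _ => ?_
    by_cases ht : t.card = s.card + 1
    · rw [coneOver_mulVec]
      split_ifs with ho
      · have : y (t.erase o) = 0 := by
          refine dif_neg fun h => hs2 ?_
          rw [Finset.card_erase_of_mem ho] at h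
          omega
        simp [this]
      · simp
    · simp [fullBoundaryOver, fullBoundary_eq_zero ht]
  refine ⟨c, ?_, ?_⟩
  · apply extend_injective
    rw [extend_boundary, hc, Matrix.mulVec_mulVec, fullBoundaryOver_mul_self,
      Matrix.zero_mulVec, map_zero]
  · funext e
    have := congrFun (congrArg (fun M => M.mulVec y) (fullBoundaryOver_mul_cone (R := R) o)) e.1
    simp only [Matrix.add_mulVec, ← Matrix.mulVec_mulVec, Matrix.one_mulVec, Pi.add_apply] at this
    rw [coneOver_mulVec, if_neg e.2.2, add_zero] at this
    rw [restrictAvoiding_apply, hc]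
    exact this.trans (dif_pos e.2)

variable (R) in
/-- In a complex with complete `1`-skeleton, the `1`-cycles are determined by their coefficients at
the edges avoiding `o`, which are arbitrary. -/
noncomputable def cyclesEquiv (hK : ∀ u v : V, u ≠ v → {u, v} ∈ K.faces) (o : V) :
    LinearMap.ker (boundary K R 1) ≃ₗ[R] (Avoiding o 2 → R) :=
  LinearEquiv.ofBijective ((restrictAvoiding K R o).domRestrict _) <| by
    constructor
    · rw [injective_iff_map_eq_zero]
      rintro ⟨c, hc⟩ h
      exact Subtype.ext (eq_zero_of_restrictAvoiding o c hc h)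
    · intro x
      obtain ⟨c, hc, hx⟩ := exists_cycle_restrictAvoiding hK o x
      exact ⟨⟨c, hc⟩, hx⟩

variable (K R) in
/-- The boundary map on `2`-chains, with only the edges avoiding `o` retained. -/
noncomputable def reducedBoundary (o : V) : Chain K R 3 →ₗ[R] (Avoiding o 2 → R) :=
  restrictAvoiding K R o ∘ₗ boundary K R 2

variable (R) in
/-- The first homology is the cokernel of the reduced boundary map. -/
noncomputable def homologyOneEquiv (hK : ∀ u v : V, u ≠ v → {u, v} ∈ K.faces) (o : V) :
    Homology K R 1 ≃ₗ[R] (Avoiding o 2 → R) ⧸ LinearMap.range (reducedBoundary K R o) :=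
  Submodule.Quotient.equiv _ _ (cyclesEquiv R hK o) <| by
    ext x
    constructor
    · rintro ⟨⟨z, hz⟩, ⟨c, rfl⟩, rfl⟩
      exact ⟨c, rfl⟩
    · rintro ⟨c, rfl⟩
      exact ⟨⟨boundary K R 2 c, boundary_boundary 0 c⟩, ⟨c, rfl⟩, rfl⟩

lemma reducedBoundary_injective_iff (o : V) :
    Function.Injective (reducedBoundary K R o) ↔ LinearMap.ker (boundary K R 2) = ⊥ := by
  rw [← LinearMap.ker_eq_bot]
  suffices LinearMap.ker (reducedBoundary K R o) = LinearMap.ker (boundary K R 2) by rw [this]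
  ext c
  simp only [LinearMap.mem_ker, reducedBoundary, LinearMap.comp_apply]
  exact ⟨eq_zero_of_restrictAvoiding o _ (boundary_boundary 0 c), fun h => by rw [h, map_zero]⟩

omit [Fintype V] in
/-- Without `3`-dimensional faces, the second homology is the module of `2`-cycles. -/
lemma subsingleton_homology_two_iff (h3 : ∀ s ∈ K.faces, s.card ≤ 3) :
    Subsingleton (Homology K R 2) ↔ LinearMap.ker (boundary K R 2) = ⊥ := by
  have : IsEmpty (FacesOfCard K (3 + 1)) := ⟨fun s => by have := h3 _ s.2.1; have := s.2.2; omega⟩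
  have hr : LinearMap.range (boundary K R 3) = ⊥ := by
    rw [LinearMap.range_eq_bot]
    exact LinearMap.ext fun c => by rw [Subsingleton.elim c 0, map_zero, map_zero]
  rw [Submodule.Quotient.subsingleton_iff, Submodule.submoduleOf,
    Submodule.comap_subtype_eq_top]
  exact (congrArg (_ ≤ ·) hr).to_iff.trans le_bot_iff

/-- The matrix of the reduced boundary map, for an identification `f` of the edges avoiding `o` with
the triangles of `K`. -/
lemma exists_reducedBoundary_eq (o : V) (f : Avoiding o 2 ≃ FacesOfCard K 3) :
    ∃ g : (Avoiding o 2 → R) ≃ₗ[R] Chain K R 3,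
      reducedBoundary K R o ∘ₗ g.toLinearMap = Matrix.mulVecLin
        (((triangleMatrix o).submatrix id fun i => ⟨(f i).1, (f i).2.2⟩).map
          (Int.cast : ℤ → R)) := by
  refine ⟨(Finsupp.linearEquivFunOnFinite R R _).symm ≪≫ₗ Finsupp.domLCongr f, ?_⟩
  refine LinearMap.pi_ext' fun i => LinearMap.ext_ring (funext fun e => ?_)
  have hi : (Finsupp.linearEquivFunOnFinite R R (Avoiding o 2)).symm (Pi.single i 1)
      = Finsupp.single i 1 := by
    rw [LinearEquiv.symm_apply_eq, Finsupp.linearEquivFunOnFinite_single]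
  simp only [LinearMap.comp_apply, LinearMap.single_apply, LinearEquiv.coe_coe,
    LinearEquiv.trans_apply, hi, Finsupp.domLCongr_single, reducedBoundary,
    restrictAvoiding_apply, Matrix.mulVecLin_apply, Matrix.mulVec_single_one]
  rw [extend_boundary 1]
  have : extend K R (1 + 2) (Finsupp.single (f i) 1) = Pi.single (f i).1 1 := by
    rw [extend, Finsupp.linearCombination_single, one_smul]
  rw [this, Matrix.mulVec_single_one]
  rfl

/-- The order of the cokernel of an integer matrix is the absolute value of its determinant. -/
lemma card_quotient_range_mulVecLin {ι : Type*} [Fintype ι] [DecidableEq ι] (A : Matrix ι ι ℤ)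
    (hA : A.det ≠ 0) :
    Nat.card ((ι → ℤ) ⧸ LinearMap.range A.mulVecLin) = A.det.natAbs := by
  have hinj : Function.Injective A.mulVecLin := Matrix.mulVec_injective_of_det_ne_zero hA
  rw [← Submodule.natAbs_det_equiv _ (LinearEquiv.ofInjective A.mulVecLin hinj)]
  congr 1
  exact LinearMap.det_toLin' A

/-- The order of the first integral homology is the absolute value of a maximal minor of the
boundary matrix. -/
lemma card_homology_one (hK : ∀ u v : V, u ≠ v → {u, v} ∈ K.faces) (o : V)
    (f : Avoiding o 2 ≃ FacesOfCard K 3)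
    (hdet : ((triangleMatrix o).submatrix id fun i => ⟨(f i).1, (f i).2.2⟩).det ≠ 0) :
    Nat.card (Homology K ℤ 1)
      = ((triangleMatrix o).submatrix id fun i => ⟨(f i).1, (f i).2.2⟩).det.natAbs := by
  obtain ⟨g, hg⟩ := exists_reducedBoundary_eq (R := ℤ) o f
  rw [← card_quotient_range_mulVecLin _ hdet, Nat.card_congr (homologyOneEquiv ℤ hK o).toEquiv]
  have : LinearMap.range (reducedBoundary K ℤ o)
      = LinearMap.range ((triangleMatrix o).submatrix id
          fun i => ⟨(f i).1, (f i).2.2⟩).mulVecLin := by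
    rw [← LinearEquiv.range_comp g (reducedBoundary K ℤ o), hg]
    congr 1
  rw [this]

/-- The rational homology vanishes in degrees `1` and `2` if and only if the reduced boundary map is
bijective. -/
lemma subsingleton_homology_iff (hK : ∀ u v : V, u ≠ v → {u, v} ∈ K.faces)
    (h3 : ∀ s ∈ K.faces, s.card ≤ 3) (o : V) :
    (Subsingleton (Homology K ℚ 1) ∧ Subsingleton (Homology K ℚ 2))
      ↔ Function.Bijective (reducedBoundary K ℚ o) := by
  rw [subsingleton_homology_two_iff h3, ← reducedBoundary_injective_iff o,
    (homologyOneEquiv ℚ hK o).toEquiv.subsingleton_congr,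
    Submodule.Quotient.subsingleton_iff, LinearMap.range_eq_top, and_comm]
  rfl

lemma reducedBoundary_bijective_iff (o : V) (f : Avoiding o 2 ≃ FacesOfCard K 3) :
    Function.Bijective (reducedBoundary K ℚ o)
      ↔ ((triangleMatrix o).submatrix id fun i => ⟨(f i).1, (f i).2.2⟩).det ≠ 0 := by
  obtain ⟨g, hg⟩ := exists_reducedBoundary_eq (R := ℚ) o f
  rw [← g.bijective.of_comp_iff, ← Int.cast_ne_zero (α := ℚ), Int.cast_det, ← isUnit_iff_ne_zero,
    ← Matrix.isUnit_iff_isUnit_det]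
  have : ⇑(reducedBoundary K ℚ o) ∘ ⇑g = Matrix.mulVec
        (((triangleMatrix o).submatrix id fun i => ⟨(f i).1, (f i).2.2⟩).map
          (Int.cast : ℤ → ℚ)) := by
    rw [← Matrix.coe_mulVecLin, ← hg]
    rfl
  rw [this]
  exact ⟨fun h => Matrix.mulVec_injective_iff_isUnit.1 h.1,
    fun h => ⟨Matrix.mulVec_injective_iff_isUnit.2 h, Matrix.mulVec_surjective_iff_isUnit.2 h⟩⟩

end Chains

/-! ### Two-trees as nonzero maximal minors -/

section Trees

variable {V : Type*} [LinearOrder V]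

/-- The complex with complete `1`-skeleton and with the set `S` of triangles. -/
def complexOfTriangles (S : Set {t : Finset V // t.card = 3}) : AbstractSimplicialComplex V where
  faces := {s | s.Nonempty ∧ (s.card ≤ 2 ∨ ∃ t ∈ S, t.1 = s)}
  isRelLowerSet_faces := by
    rintro s ⟨hs, h⟩
    refine ⟨hs, fun t hts ht => ⟨ht, ?_⟩⟩
    rcases h with h | ⟨r, hr, rfl⟩
    · exact Or.inl ((Finset.card_le_card hts).trans h)
    · rcases (show t ⊆ r.1 from hts).eq_or_ssubset with rfl | hlt
      · exact Or.inr ⟨r, hr, rfl⟩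
      · have := Finset.card_lt_card hlt
        rw [r.2] at this
        exact Or.inl (by omega)
  singleton_mem v := ⟨Finset.singleton_nonempty v, Or.inl (by simp)⟩

lemma complexOfTriangles_complete (S : Set {t : Finset V // t.card = 3}) (u v : V) (huv : u ≠ v) :
    {u, v} ∈ (complexOfTriangles S).faces :=
  ⟨⟨u, by simp⟩, Or.inl (Finset.card_pair huv).le⟩

omit [LinearOrder V] in
lemma complexOfTriangles_card_le (S : Set {t : Finset V // t.card = 3}) (s : Finset V)
    (hs : s ∈ (complexOfTriangles S).faces) : s.card ≤ 3 := by
  rcases hs.2 with h | ⟨t, -, rfl⟩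
  · omega
  · exact t.2.le

omit [LinearOrder V] in
lemma mem_complexOfTriangles (S : Set {t : Finset V // t.card = 3})
    (t : {t : Finset V // t.card = 3}) : t.1 ∈ (complexOfTriangles S).faces ↔ t ∈ S := by
  constructor
  · rintro ⟨-, h | ⟨r, hr, hrt⟩⟩
    · have := t.2; omega
    · rwa [← Subtype.ext hrt]
  · intro ht
    exact ⟨Finset.card_pos.1 (by rw [t.2]; norm_num), Or.inr ⟨t, ht, rfl⟩⟩

variable [Fintype V]

/-- Columns carrying a nonzero minor are distinct, so they index the triangles of a complex. -/
lemma exists_equiv_of_det_ne_zero {o : V} {f : Avoiding o 2 → {t : Finset V // t.card = 3}}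
    (hf : ((triangleMatrix o).submatrix id f).det ≠ 0) :
    ∃ e : Avoiding o 2 ≃ FacesOfCard (complexOfTriangles (Set.range f)) 3,
      (fun i => (⟨(e i).1, (e i).2.2⟩ : {t : Finset V // t.card = 3})) = f := by
  have hinj : Function.Injective f := by
    intro i j hij
    by_contra hne
    refine hf (Matrix.det_zero_of_column_eq hne fun k => ?_)
    simp [hij]
  refine ⟨Equiv.ofBijective (fun i => ⟨(f i).1,
    (mem_complexOfTriangles _ _).2 ⟨i, rfl⟩, (f i).2⟩) ⟨?_, ?_⟩, rfl⟩
  · intro i j hij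
    exact hinj (Subtype.ext (congrArg (fun t : FacesOfCard _ 3 => t.1) hij))
  · rintro ⟨t, ht, hc⟩
    obtain ⟨i, hi⟩ := (mem_complexOfTriangles (Set.range f) ⟨t, hc⟩).1 ht
    exact ⟨i, Subtype.ext (congrArg (fun t : {t : Finset V // t.card = 3} => t.1) hi)⟩

/-- A nonzero maximal minor yields a `2`-tree. -/
lemma isTwoTree_of_det_ne_zero (hV : 3 ≤ Fintype.card V) {o : V}
    {f : Avoiding o 2 → {t : Finset V // t.card = 3}}
    (hf : ((triangleMatrix o).submatrix id f).det ≠ 0) :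
    IsTwoTree (complexOfTriangles (Set.range f)) := by
  obtain ⟨e, he⟩ := exists_equiv_of_det_ne_zero hf
  have hbij : Function.Bijective (reducedBoundary (complexOfTriangles (Set.range f)) ℚ o) := by
    rw [reducedBoundary_bijective_iff o e, he]
    exact hf
  have hh := (subsingleton_homology_iff (complexOfTriangles_complete _)
    (complexOfTriangles_card_le _) o).2 hbij
  refine ⟨complexOfTriangles_card_le _, ?_, complexOfTriangles_complete _, hh.1, hh.2⟩
  have hpos : 0 < Fintype.card (Avoiding o 2) := by
    rw [card_avoiding]
    exact Nat.choose_pos (by omega)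
  obtain ⟨i⟩ := Fintype.card_pos_iff.1 hpos
  exact ⟨(e i).1, (e i).2.1, (e i).2.2⟩

/-- The triangles of a `2`-tree are as many as the edges avoiding `o`. -/
lemma IsTwoTree.nonempty_equiv {K : AbstractSimplicialComplex V} (hK : IsTwoTree K) (o : V) :
    Nonempty (Avoiding o 2 ≃ FacesOfCard K 3) := by
  have := Fintype.ofFinite (FacesOfCard K 3)
  have hbij := (subsingleton_homology_iff hK.complete hK.card_le o).1
    ⟨hK.homology_one, hK.homology_two⟩
  have h := (LinearEquiv.ofBijective _ hbij).finrank_eq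
  rw [Module.finrank_finsupp_self, Module.finrank_fintype_fun_eq_card] at h
  exact ⟨Fintype.equivOfCardEq h.symm⟩

/-- The order of the first homology of a `2`-tree as a maximal minor. -/
lemma IsTwoTree.card_homology_one {K : AbstractSimplicialComplex V} (hK : IsTwoTree K) (o : V)
    (e : Avoiding o 2 ≃ FacesOfCard K 3) :
    Nat.card (Homology K ℤ 1)
      = ((triangleMatrix o).submatrix id fun i => ⟨(e i).1, (e i).2.2⟩).det.natAbs := by
  refine Hypertree.card_homology_one hK.complete o e ?_
  rw [← reducedBoundary_bijective_iff o e, ← subsingleton_homology_iff hK.complete hK.card_le o]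
  exact ⟨hK.homology_one, hK.homology_two⟩

lemma sum_abs_triangleMatrix_le (o : V) (t : {t : Finset V // t.card = 3}) :
    ∑ e, |triangleMatrix o e t| ≤ 3 := by
  have h : ∀ e, |triangleMatrix o e t| ≤ ∑ u ∈ t.1, if t.1.erase u = e.1 then (1 : ℤ) else 0 := by
    intro e
    rw [triangleMatrix, Matrix.submatrix_apply, fullBoundary_apply]
    refine (Finset.abs_sum_le_sum_abs _ _).trans (Finset.sum_le_sum fun u _ => ?_)
    split_ifs <;> simp [sgn]
  refine (Finset.sum_le_sum fun e _ => h e).trans ?_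
  rw [Finset.sum_comm]
  calc _ ≤ ∑ u ∈ t.1, (1 : ℤ) := by
        refine Finset.sum_le_sum fun u _ => ?_
        rw [← Finset.sum_filter, Finset.sum_const, nsmul_eq_mul, mul_one]
        have hle : (Finset.univ.filter fun e : Avoiding o 2 => t.1.erase u = e.1).card ≤ 1 :=
          Finset.card_le_one.2 fun a ha b hb => Subtype.ext
            ((Finset.mem_filter.1 ha).2.symm.trans (Finset.mem_filter.1 hb).2)
        exact_mod_cast hle
    _ = 3 := by rw [Finset.sum_const, t.2]; norm_num

end Trees

section Measure

variable {n : ℕ}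

lemma mem_twoTrees {K : AbstractSimplicialComplex (Fin n)} : K ∈ twoTrees n ↔ IsTwoTree K := by
  simp [twoTrees]

lemma orderH1_nonneg (K : AbstractSimplicialComplex (Fin n)) : 0 ≤ orderH1 K := Nat.cast_nonneg _

lemma orderH1_le (hn : 3 ≤ n) {K : AbstractSimplicialComplex (Fin n)} (hK : IsTwoTree K) :
    orderH1 K ≤ 3 ^ (n - 1).choose 2 := by
  let o : Fin n := ⟨0, by omega⟩
  obtain ⟨e⟩ := hK.nonempty_equiv o
  have h1 := abs_det_le_prod_sum
    ((triangleMatrix o).submatrix id fun i => (⟨(e i).1, (e i).2.2⟩ : {t // t.card = 3}))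
  have h2 : ∏ j : Avoiding o 2, ∑ i, |(triangleMatrix o).submatrix id
      (fun i => (⟨(e i).1, (e i).2.2⟩ : {t : Finset (Fin n) // t.card = 3})) i j|
        ≤ ∏ _j : Avoiding o 2, (3 : ℤ) :=
    Finset.prod_le_prod (fun j _ => Finset.sum_nonneg fun i _ => abs_nonneg _)
      fun j _ => sum_abs_triangleMatrix_le o _
  rw [Finset.prod_const, Finset.card_univ, card_avoiding, Fintype.card_fin] at h2
  rw [orderH1, hK.card_homology_one o e, Nat.cast_natAbs]
  exact_mod_cast h1.trans h2

/-- **Kalai's theorem**, the lower bound: the sum of the squared orders of the first homology groups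
over all `2`-trees. -/
lemma pow_le_sum_orderH1_sq (hn : 3 ≤ n) :
    (n : ℝ) ^ (n - 2).choose 2 ≤ ∑ T ∈ twoTrees n, orderH1 T ^ 2 := by
  classical
  let o : Fin n := ⟨0, by omega⟩
  let D : (Avoiding o 2 → {t : Finset (Fin n) // t.card = 3}) → ℤ :=
    fun f => ((triangleMatrix o).submatrix id f).det
  let F := Finset.univ.filter fun f => D f ≠ 0
  have hsum : ∑ f, D f ^ 2 = ((n - 1).choose 2).factorial * (n : ℤ) ^ (n - 2).choose 2 := by
    have := sum_sq_det_triangleMatrix o (by simpa using hn)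
    rwa [Fintype.card_fin] at this
  have hmaps : ∀ f ∈ F, complexOfTriangles (Set.range f) ∈ twoTrees n := fun f hf =>
    mem_twoTrees.2 (isTwoTree_of_det_ne_zero (by simpa using hn) (Finset.mem_filter.1 hf).2)
  have hD : ∀ f ∈ F, ((D f : ℤ) : ℝ) ^ 2 = orderH1 (complexOfTriangles (Set.range f)) ^ 2 := by
    intro f hf
    obtain ⟨e, he⟩ := exists_equiv_of_det_ne_zero (Finset.mem_filter.1 hf).2
    rw [orderH1, (mem_twoTrees.1 (hmaps f hf)).card_homology_one o e, he, Nat.cast_natAbs,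
      Int.cast_abs, sq_abs]
  -- A `2`-tree arises only from the orderings of its set of triangles.
  have hfib : ∀ T ∈ twoTrees n,
      (F.filter fun f => complexOfTriangles (Set.range f) = T).card
        ≤ ((n - 1).choose 2).factorial := by
    intro T hT
    have := Fintype.ofFinite (FacesOfCard T 3)
    obtain ⟨e₀⟩ := (mem_twoTrees.1 hT).nonempty_equiv o
    have hcard : Fintype.card (Avoiding o 2 ≃ FacesOfCard T 3)
        = ((n - 1).choose 2).factorial := by
      rw [Fintype.card_equiv e₀, card_avoiding, Fintype.card_fin]
    rw [← hcard, ← Finset.card_univ]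
    refine le_trans (Finset.card_le_card ?_) (Finset.card_image_le
      (f := fun e : Avoiding o 2 ≃ FacesOfCard T 3 =>
        fun i => (⟨(e i).1, (e i).2.2⟩ : {t : Finset (Fin n) // t.card = 3})))
    intro f hf
    obtain ⟨hfF, rfl⟩ := Finset.mem_filter.1 hf
    obtain ⟨e, he⟩ := exists_equiv_of_det_ne_zero (Finset.mem_filter.1 hfF).2
    exact Finset.mem_image.2 ⟨e, Finset.mem_univ _, he⟩
  have hmain : ((n - 1).choose 2).factorial * (n : ℝ) ^ (n - 2).choose 2
      ≤ ((n - 1).choose 2).factorial * ∑ T ∈ twoTrees n, orderH1 T ^ 2 := by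
    calc _ = ∑ f, ((D f : ℤ) : ℝ) ^ 2 := by exact_mod_cast hsum.symm
      _ = ∑ f ∈ F, ((D f : ℤ) : ℝ) ^ 2 := by
          refine (Finset.sum_filter_of_ne fun f _ hf => ?_).symm
          intro h0
          simp [h0] at hf
      _ = ∑ f ∈ F, orderH1 (complexOfTriangles (Set.range f)) ^ 2 := Finset.sum_congr rfl hD
      _ = ∑ T ∈ twoTrees n, ∑ f ∈ F with complexOfTriangles (Set.range f) = T,
            orderH1 (complexOfTriangles (Set.range f)) ^ 2 :=
          (Finset.sum_fiberwise_of_maps_to hmaps _).symm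
      _ ≤ ∑ T ∈ twoTrees n, ((n - 1).choose 2).factorial * orderH1 T ^ 2 := by
          refine Finset.sum_le_sum fun T hT => ?_
          have : ∀ f ∈ F.filter (fun f => complexOfTriangles (Set.range f) = T),
              orderH1 (complexOfTriangles (Set.range f)) ^ 2 = orderH1 T ^ 2 := by
            intro f hf
            rw [(Finset.mem_filter.1 hf).2]
          rw [Finset.sum_congr rfl this, Finset.sum_const, nsmul_eq_mul]
          exact mul_le_mul_of_nonneg_right (by exact_mod_cast hfib T hT) (sq_nonneg _)
      _ = _ := by rw [Finset.mul_sum]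
  exact le_of_mul_le_mul_left hmain (by exact_mod_cast Nat.factorial_pos _)

/-- A `2`-tree is determined by its `(n - 1).choose 2` triangles. -/
lemma card_twoTrees_le (hn : 3 ≤ n) :
    (twoTrees n).card ≤ (n.choose 3).choose ((n - 1).choose 2) := by
  classical
  let o : Fin n := ⟨0, by omega⟩
  let τ : AbstractSimplicialComplex (Fin n) → Finset (Finset (Fin n)) :=
    fun T => (Finset.univ.powersetCard 3).filter (· ∈ T.faces)
  have hτ : ∀ T s, s ∈ τ T ↔ s ∈ T.faces ∧ s.card = 3 := by
    intro T s
    simp only [τ, Finset.mem_filter, Finset.mem_powersetCard_univ]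
    tauto
  have hcard : ((Finset.univ.powersetCard 3 : Finset (Finset (Fin n))).powersetCard
      ((n - 1).choose 2)).card = (n.choose 3).choose ((n - 1).choose 2) := by simp
  rw [← hcard]
  refine Finset.card_le_card_of_injOn τ ?_ ?_
  · intro T hT
    obtain ⟨e⟩ := (mem_twoTrees.1 hT).nonempty_equiv o
    refine Finset.mem_coe.2 (Finset.mem_powersetCard.2 ⟨Finset.filter_subset _ _, ?_⟩)
    have h := Fintype.card_congr (e.trans (Equiv.subtypeEquivRight fun s => (hτ T s).symm))
    rwa [card_avoiding, Fintype.card_fin, Fintype.card_coe, eq_comm] at h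
  · intro T hT T' hT' h
    have hT := mem_twoTrees.1 hT
    have hT' := mem_twoTrees.1 hT'
    have key : ∀ {A B : AbstractSimplicialComplex (Fin n)}, IsTwoTree A → IsTwoTree B →
        τ A = τ B → A.faces ⊆ B.faces := by
      intro A B hA hB hAB s hs
      have h3 := hA.card_le s hs
      have h0 : 0 < s.card := Finset.card_pos.2 (A.isRelLowerSet_faces hs).1
      obtain h1 | h2 | h3 : s.card = 1 ∨ s.card = 2 ∨ s.card = 3 := by omega
      · obtain ⟨v, rfl⟩ := Finset.card_eq_one.1 h1
        exact B.singleton_mem v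
      · obtain ⟨u, v, huv, rfl⟩ := Finset.card_eq_two.1 h2
        exact hB.complete u v huv
      · exact ((hτ B s).1 (hAB ▸ (hτ A s).2 ⟨hs, h3⟩)).1
    exact AbstractSimplicialComplex.ext ((key hT hT' h).antisymm (key hT' hT h.symm))

end Measure

/-! ### Estimates -/

section Estimates

/-- A power mean inequality. -/
lemma sum_sq_pow_three_le {ι : Type*} (s : Finset ι) (h : ι → ℝ) (h0 : ∀ i, 0 ≤ h i) :
    (∑ i ∈ s, h i ^ 2) ^ 3 ≤ (∑ i ∈ s, h i ^ 3) ^ 2 * s.card := by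
  have hS : 0 ≤ ∑ i ∈ s, h i ^ 2 := Finset.sum_nonneg fun i _ => sq_nonneg _
  -- Cauchy–Schwarz twice, between the exponents `1` and `3` and between `0` and `2`.
  have h13 : (∑ i ∈ s, h i ^ 2) ^ 2 ≤ (∑ i ∈ s, h i) * ∑ i ∈ s, h i ^ 3 :=
    Finset.sum_sq_le_sum_mul_sum_of_sq_le_mul s (fun i _ => h0 i)
      (fun i _ => pow_nonneg (h0 i) 3) fun i _ => by ring_nf; rfl
  have h1 : (∑ i ∈ s, h i) ^ 2 ≤ s.card * ∑ i ∈ s, h i ^ 2 := sq_sum_le_card_mul_sum_sq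
  rcases hS.eq_or_lt with h2 | h2
  · rw [← h2, zero_pow three_ne_zero]
    positivity
  refine le_of_mul_le_mul_left ?_ h2
  calc _ = ((∑ i ∈ s, h i ^ 2) ^ 2) ^ 2 := by ring
    _ ≤ ((∑ i ∈ s, h i) * ∑ i ∈ s, h i ^ 3) ^ 2 := by gcongr
    _ = (∑ i ∈ s, h i) ^ 2 * (∑ i ∈ s, h i ^ 3) ^ 2 := by ring
    _ ≤ (s.card * ∑ i ∈ s, h i ^ 2) * (∑ i ∈ s, h i ^ 3) ^ 2 := by gcongr
    _ = _ := by ring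

/-- The bound `M.choose m ≤ (e * M / m) ^ m`, without the division. -/
lemma choose_le_exp_mul_pow (M m : ℕ) (x : ℝ) (hx : (M : ℝ) = x * m) :
    ((M.choose m : ℕ) : ℝ) ≤ (Real.exp 1 * x) ^ m := by
  rcases m.eq_zero_or_pos with rfl | hm
  · simp
  have hx0 : 0 ≤ x := by
    by_contra! h
    have : x * m < 0 := mul_neg_of_neg_of_pos h (by exact_mod_cast hm)
    have hM : (0 : ℝ) ≤ M := Nat.cast_nonneg _
    linarith
  calc ((M.choose m : ℕ) : ℝ) ≤ (M : ℝ) ^ m / m.factorial := Nat.choose_le_pow_div m M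
    _ = x ^ m * ((m : ℝ) ^ m / m.factorial) := by rw [hx, mul_pow, mul_div_assoc]
    _ ≤ x ^ m * Real.exp m := by
        gcongr
        exact Real.pow_div_factorial_le_exp _ (Nat.cast_nonneg _) _
    _ = _ := by rw [mul_pow, ← Real.exp_nat_mul, mul_one, mul_comm]

lemma choose_two_eq {n : ℕ} (hn : 3 ≤ n) :
    (n - 1).choose 2 = (n - 2).choose 2 + (n - 2) := by
  obtain ⟨k, rfl⟩ : ∃ k, n = k + 2 := ⟨n - 2, by omega⟩
  rw [show k + 2 - 1 = k + 1 from rfl, Nat.add_sub_cancel, Nat.choose_succ_succ' k 1,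
    Nat.choose_one_right, add_comm]

lemma cast_card_twoTrees_le {n : ℕ} (hn : 3 ≤ n) :
    ((twoTrees n).card : ℝ) ≤ (Real.exp 1 * (n / 3)) ^ (n - 1).choose 2 := by
  refine (Nat.cast_le.2 (card_twoTrees_le hn)).trans (choose_le_exp_mul_pow _ _ _ ?_)
  obtain ⟨k, rfl⟩ : ∃ k, n = k + 1 := ⟨n - 1, by omega⟩
  have h : ((k + 1 : ℕ) : ℝ) * (k.choose 2 : ℕ) = ((k + 1).choose 3 : ℕ) * 3 := by
    exact_mod_cast Nat.add_one_mul_choose_eq k 2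
  rw [Nat.add_sub_cancel]
  linarith

lemma expectedOrderH1_eq (n : ℕ) :
    expectedOrderH1 n = (∑ T ∈ twoTrees n, orderH1 T ^ 3) / ∑ T ∈ twoTrees n, orderH1 T ^ 2 := by
  rw [expectedOrderH1, Finset.sum_div]
  refine Finset.sum_congr rfl fun T _ => ?_
  rw [prob]
  ring

/-- The expectation is at least the square root of `∑ h ^ 2 / N`, with `N` the number of
`2`-trees. -/
lemma expectedOrderH1_lower {n : ℕ} (hn : 3 ≤ n) :
    Real.sqrt (3 / Real.exp 1) ^ ((n - 2).choose 2)
        * Real.sqrt (3 / (Real.exp 1 * (n : ℝ))) ^ (n - 2) ≤ expectedOrderH1 n := by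
  have hn0 : (0 : ℝ) < n := by exact_mod_cast (by omega : 0 < n)
  have he : (0 : ℝ) < Real.exp 1 := Real.exp_pos 1
  set A := ∑ T ∈ twoTrees n, orderH1 T ^ 2 with hA
  set B := ∑ T ∈ twoTrees n, orderH1 T ^ 3 with hB
  set N : ℝ := ((twoTrees n).card : ℝ) with hN
  have hKalai : (n : ℝ) ^ (n - 2).choose 2 ≤ A := pow_le_sum_orderH1_sq hn
  have hApos : 0 < A := lt_of_lt_of_le (by positivity) hKalai
  have hBnn : 0 ≤ B := Finset.sum_nonneg fun T _ => pow_nonneg (orderH1_nonneg T) 3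
  have hmean : A ^ 3 ≤ B ^ 2 * N := sum_sq_pow_three_le _ _ orderH1_nonneg
  have hNle : N ≤ (Real.exp 1 * (n / 3)) ^ (n - 1).choose 2 := cast_card_twoTrees_le hn
  rw [expectedOrderH1_eq, ← hA, ← hB]
  refine (sq_le_sq₀ (by positivity) (by positivity)).1 ?_
  have hsq : (Real.sqrt (3 / Real.exp 1) ^ ((n - 2).choose 2)
      * Real.sqrt (3 / (Real.exp 1 * (n : ℝ))) ^ (n - 2)) ^ 2
        = (n : ℝ) ^ (n - 2).choose 2 / (Real.exp 1 * (n / 3)) ^ (n - 1).choose 2 := by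
    have e1 : 3 / (Real.exp 1 * (n : ℝ)) = (Real.exp 1 * (n / 3))⁻¹ := by field_simp
    have e2 : 3 / Real.exp 1 = n / (Real.exp 1 * (n / 3)) := by field_simp
    rw [mul_pow, ← pow_mul, ← pow_mul, mul_comm _ 2, mul_comm _ 2, pow_mul, pow_mul,
      Real.sq_sqrt (by positivity), Real.sq_sqrt (by positivity), choose_two_eq hn, pow_add,
      e1, e2, div_pow, inv_pow, ← div_div, ← div_eq_mul_inv]
  rw [hsq, div_pow, div_le_div_iff₀ (by positivity) (by positivity)]
  calc _ ≤ A * A ^ 2 := by gcongr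
    _ = A ^ 3 := by ring
    _ ≤ B ^ 2 * N := hmean
    _ ≤ _ := by gcongr

lemma expectedOrderH1_upper {n : ℕ} (hn : 3 ≤ n) :
    expectedOrderH1 n ≤ 3 ^ (n - 1).choose 2 := by
  rw [expectedOrderH1_eq]
  refine div_le_of_le_mul₀ (Finset.sum_nonneg fun T _ => sq_nonneg _) (by positivity) ?_
  rw [Finset.mul_sum]
  refine Finset.sum_le_sum fun T hT => ?_
  rw [pow_succ' (orderH1 T) 2]
  exact mul_le_mul_of_nonneg_right (orderH1_le hn (mem_twoTrees.1 hT)) (sq_nonneg _)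

/-- As `3 > e`, the first factor grows like the exponential of a multiple of `n ^ 2`, and the second
one only decays like the exponential of a multiple of `n * log n`. -/
lemma exists_exp_le_lower_bound : ∃ c : ℝ, 0 < c ∧ ∃ N : ℕ, ∀ n : ℕ, N ≤ n →
    Real.exp (c * (n : ℝ) ^ 2) ≤ Real.sqrt (3 / Real.exp 1) ^ ((n - 2).choose 2)
        * Real.sqrt (3 / (Real.exp 1 * (n : ℝ))) ^ (n - 2) := by
  set a : ℝ := Real.log 3 - 1 with ha
  have hapos : 0 < a := by
    rw [ha, sub_pos, Real.lt_log_iff_exp_lt (by norm_num)]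
    exact Real.exp_one_lt_three
  -- The logarithm of the bound is `(a * (n - 1) * (n - 2) / 2 - (n - 2) * log n) / 2`, where
  -- `(n - 1) * (n - 2) / 2 ≥ n ^ 2 / 8` for `n ≥ 4` and `log n ≤ a / 16 * n` for large `n`.
  refine ⟨a / 32, by positivity, ?_⟩
  have hlog := (Real.isLittleO_log_id_atTop.bound (by positivity : 0 < a / 16)).natCast_atTop
  obtain ⟨N, hN⟩ := Filter.eventually_atTop.1 hlog
  refine ⟨max N 4, fun n hn => ?_⟩
  have hn4 : 4 ≤ n := (le_max_right _ _).trans hn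
  have hn4' : (4 : ℝ) ≤ n := by exact_mod_cast hn4
  have hlogn : Real.log n ≤ a / 16 * n := by
    have := hN n ((le_max_left _ _).trans hn)
    simp only [id, Real.norm_eq_abs, Nat.abs_cast] at this
    exact (le_abs_self _).trans this
  have hlognn : 0 ≤ Real.log n := Real.log_nonneg (by linarith)
  have hs1 : Real.sqrt (3 / Real.exp 1) = Real.exp (a / 2) := by
    rw [Real.sqrt_eq_iff_mul_self_eq_of_pos (Real.exp_pos _), ← Real.exp_add, add_halves, ha,
      Real.exp_sub, Real.exp_log (by norm_num)]
  have hs2 : Real.sqrt (3 / (Real.exp 1 * (n : ℝ))) = Real.exp ((a - Real.log n) / 2) := by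
    rw [Real.sqrt_eq_iff_mul_self_eq_of_pos (Real.exp_pos _), ← Real.exp_add, add_halves, ha,
      Real.exp_sub, Real.exp_sub, Real.exp_log (by norm_num), Real.exp_log (by linarith),
      div_div]
  rw [hs1, hs2, ← Real.exp_nat_mul, ← Real.exp_nat_mul, ← Real.exp_add, Real.exp_le_exp,
    Nat.cast_choose_two, Nat.cast_sub (by omega : 2 ≤ n)]
  push_cast
  have h1 : ((n : ℝ) - 2) * Real.log n ≤ n * (a / 16 * n) :=
    mul_le_mul (by linarith) hlogn hlognn (by linarith)
  nlinarith [mul_nonneg hapos.le (by nlinarith : (0 : ℝ) ≤ 3 * (n : ℝ) ^ 2 - 12 * n + 8)]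

end Estimates

end Hypertree

theorem theorem4p3 :
    (∀ n : ℕ, 3 ≤ n →
      Real.sqrt (3 / Real.exp 1) ^ ((n - 2).choose 2)
          * Real.sqrt (3 / (Real.exp 1 * (n : ℝ))) ^ (n - 2)
        ≤ Hypertree.expectedOrderH1 n) ∧
    (∃ c C : ℝ, 0 < c ∧ 0 < C ∧ ∃ N : ℕ, ∀ n : ℕ, N ≤ n →
      Real.exp (c * (n : ℝ) ^ 2) ≤ Hypertree.expectedOrderH1 n ∧
        Hypertree.expectedOrderH1 n ≤ Real.exp (C * (n : ℝ) ^ 2)) := by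
  refine ⟨fun n hn => Hypertree.expectedOrderH1_lower hn, ?_⟩
  obtain ⟨c, hc, N, hN⟩ := Hypertree.exists_exp_le_lower_bound
  refine ⟨c, 2, hc, by norm_num, max N 3, fun n hn => ?_⟩
  have hn3 : 3 ≤ n := (le_max_right _ _).trans hn
  refine ⟨(hN n ((le_max_left _ _).trans hn)).trans (Hypertree.expectedOrderH1_lower hn3),
    (Hypertree.expectedOrderH1_upper hn3).trans ?_⟩
  have hm : (((n - 1).choose 2 : ℕ) : ℝ) ≤ (n : ℝ) ^ 2 := by
    exact_mod_cast (Nat.choose_le_pow _ _).trans (Nat.pow_le_pow_left (Nat.sub_le n 1) 2)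
  have h3 : (3 : ℝ) ≤ Real.exp 2 := by
    have := Real.add_one_le_exp (2 : ℝ)
    linarith
  calc (3 : ℝ) ^ (n - 1).choose 2 ≤ Real.exp 2 ^ (n - 1).choose 2 := by gcongr
    _ = Real.exp (((n - 1).choose 2 : ℕ) * 2) := (Real.exp_nat_mul _ _).symm
    _ ≤ Real.exp (2 * (n : ℝ) ^ 2) := Real.exp_le_exp.2 (by linarith)
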